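/- Throughout, $2$-categories, $2$-functors and $2$-natural transformations are strict. Let $P,A,B,C$ be $2$-categories, let $p:P\to A$, $q:P\to B$, $f:A\to C$, $g:B\to C$ be $2$-functors, and let $\phi: fp\Rightarrow gq$ be a $2$-natural transformation (a lax square of $2$-categories). For a category $X$ let $\pi_0X$ be its set of connected components; a functor is *inverted by $\pi_0$* if it induces a bijection between these sets. For a $2$-category $X$ let $\pi_{0*}X$ be the category with the same objects and with $(\pi_{0*}X)(x,y)=\pi_0(X(x,y))$; this is functorial in $2$-functors and $2$-natural transformations, so the lax square has an image under $\pi_{0*}$, which is a lax square of categories. A lax square of categories $(p,q,f,g,\phi:fp\Rightarrow gq)$ is *exact* if for all objects $a$ of $A$ and $b$ of $B$ the function $$\tilde\phi_{a,b}:\int^{x\in P}B(qx,b)\times A(a,px)\longrightarrow C(fa,gb)$$ induced by $(\beta,\alpha)\mapsto g\beta\circ\phi_x\circ f\alpha$ is a bijection. The given lax square of $2$-categories is *$\pi_0$-exact* if its image under $\pi_{0*}$ is an exact lax square of categories. For objects $a$ of $A$ and $b$ of $B$ let $\mathcal F(\phi,a,b)$ be the following category. Its objects are triples $(x,y,z)$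 with $x$ an object of $P$ and $y:qx\to b$ and $z:a\to px$ $1$-cells. A morphism $(x_1,y_1,z_1)\to(x_2,y_2,z_2)$ is a triple $(h,h_1,h_2)$ of a $1$-cell $h:x_1\to x_2$ of $P$ and $2$-cells $h_1:y_1\Rightarrow y_2\circ q(h)$ and $h_2:p(h)\circ z_1\Rightarrow z_2$; identities are given by identity cells and composition by pasting. Let $$\mathcal C(\phi,a,b):\mathcal F(\phi,a,b)\longrightarrow C(fa,gb)$$ be the functor into the hom-category which is given on objects by $(x,y,z)\mapsto g(y)\circ\phi_x\circ f(z)$, and which sends $(h,h_1,h_2)$ to the composite $2$-cell $$g(y_1)\,\phi_{x_1}\,f(z_1)\;\Rightarrow\; g(y_2)\,gq(h)\,\phi_{x_1}\,f(z_1)\;=\;g(y_2)\,\phi_{x_2}\,fp(h)\,f(z_1)\;\Rightarrow\; g(y_2)\,\phi_{x_2}\,f(z_2)$$ whose two arrows are obtained by whiskering $g(h_1)$ and $f(h_2)$. **Proposition.** The lax square is $\pi_0$-exact if and only if, for all objects $a$ of $A$ and $b$ of $B$, the functor $\mathcal C(\phi,a,b)$ is inverted by $\pi_0$. -/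

import Mathlib

/-!
# π₀-exact lax squares of 2-categories

A 2-category is a Mathlib bicategory that is `Bicategory.Strict`, a 2-functor is a
`StrictPseudofunctor`. In a diagram of the form
```
        q
    P ------> B
    |         |
  p |   φ ⇒   | g
    v         v
    A ------> C
        f
```
`φ` is a 2-natural transformation from `f ∘ p` to `g ∘ q`. Composition is written in diagrammatic
order, so that for instance `g(y) ∘ φ_x ∘ f(z)` is `f.map z ≫ φ.app x ≫ g.map y`.
-/

open CategoryTheory Bicategory

universe w₁ w₂ w₃ w₄ v₁ v₂ v₃ v₄ u₁ u₂ u₃ u₄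

namespace PiZeroExact

section PiZeroStar

/-- The category `π₀⁎ X` obtained from a 2-category `X` by applying `π₀` to the homs:
it has the objects of `X`, and a morphism is a connected component of a hom-category of `X`. -/
structure PiZeroStar (X : Type u₁) where
  /-- The underlying object of the 2-category. -/
  as : X

namespace PiZeroStar

/-- The connected component of a 1-cell. -/
abbrev cc {X : Type u₁} [Bicategory.{w₁, v₁} X] {x y : X} (h : x ⟶ y) :
    CategoryTheory.ConnectedComponents (x ⟶ y) :=
  CategoryTheory.ConnectedComponents.mk h

variable {X : Type u₁} [Bicategory.{w₁, v₁} X]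

/-- Composition of connected components of 1-cells. -/
def compCC {x y z : X} (s : CategoryTheory.ConnectedComponents (x ⟶ y)) (t : CategoryTheory.ConnectedComponents (y ⟶ z)) :
    CategoryTheory.ConnectedComponents (x ⟶ z) :=
  Quotient.map₂ (fun (h : x ⟶ y) (k : y ⟶ z) => h ≫ k)
    (fun h h' (hh : Zigzag h h') k k' (hk : Zigzag k k') =>
      (zigzag_obj_of_zigzag (postcomp x k) hh).trans
        (zigzag_obj_of_zigzag (precomp z h') hk)) s t

instance [Strict X] : Category.{v₁} (PiZeroStar X) where
  Hom x y := CategoryTheory.ConnectedComponents (x.as ⟶ y.as)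
  id x := cc (𝟙 x.as)
  comp s t := compCC s t
  id_comp := by
    rintro x y ⟨h⟩
    exact congrArg cc (Strict.id_comp h)
  comp_id := by
    rintro x y ⟨h⟩
    exact congrArg cc (Strict.comp_id h)
  assoc := by
    rintro x y z t ⟨h⟩ ⟨k⟩ ⟨l⟩
    exact congrArg cc (Strict.assoc h k l)

variable [Strict X] {Y : Type u₂} [Bicategory.{w₂, v₂} Y] [Strict Y]

/-- The action of `π₀⁎` on 2-functors. -/
def map (F : StrictPseudofunctor X Y) : PiZeroStar X ⥤ PiZeroStar Y where
  obj x := ⟨F.obj x.as⟩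
  map {x y} s := (F.mapFunctor x.as y.as).mapConnectedComponents s
  map_id x := congrArg cc (F.map_id x.as)
  map_comp := by
    rintro x y z ⟨h⟩ ⟨k⟩
    exact congrArg cc (F.map_comp h k)

end PiZeroStar

end PiZeroStar

section ExactSquare

variable {P : Type u₁} [Category.{v₁} P] {A : Type u₂} [Category.{v₂} A]
  {B : Type u₃} [Category.{v₃} B] {C : Type u₄} [Category.{v₄} C]
  {p : P ⥤ A} {q : P ⥤ B} {f : A ⥤ C} {g : B ⥤ C}

/-- The relation which presents the coend `∫^x B(qx,b) × A(a,px)` as a quotient of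
`Σ x, B(qx,b) × A(a,px)`: for `h : x₁ ⟶ x₂` in `P`, `β : q x₂ ⟶ b` and `α : a ⟶ p x₁`, the
elements `(β ∘ qh, α)` at `x₁` and `(β, ph ∘ α)` at `x₂` are identified. -/
inductive CoendRel (p : P ⥤ A) (q : P ⥤ B) (a : A) (b : B) :
    (Σ x : P, (q.obj x ⟶ b) × (a ⟶ p.obj x)) → (Σ x : P, (q.obj x ⟶ b) × (a ⟶ p.obj x)) → Prop
  | intro {x₁ x₂ : P} (h : x₁ ⟶ x₂) (β : q.obj x₂ ⟶ b) (α : a ⟶ p.obj x₁) :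
      CoendRel p q a b ⟨x₁, (q.map h ≫ β, α)⟩ ⟨x₂, (β, α ≫ p.map h)⟩

/-- The value at `(a, b)` of the composite profunctor `B(q,1) ∘ A(1,p)`, that is the coend
`∫^x B(qx,b) × A(a,px)` in sets. -/
def ProfComp (p : P ⥤ A) (q : P ⥤ B) (a : A) (b : B) : Type (max u₁ v₂ v₃) :=
  Quot (CoendRel p q a b)

/-- The component at `(a, b)` of the 2-cell of profunctors
`φ̃ : B(q,1) ∘ A(1,p) ⟶ C(f,g)` which corresponds to `φ : f ∘ p ⟶ g ∘ q`. It is induced by the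
dinatural family `(β, α) ↦ g β ∘ φ_x ∘ f α`. -/
def profTrans (φ : p ⋙ f ⟶ q ⋙ g) (a : A) (b : B) :
    ProfComp p q a b → (f.obj a ⟶ g.obj b) :=
  Quot.lift (fun s => f.map s.2.2 ≫ φ.app s.1 ≫ g.map s.2.1) (by
    rintro _ _ ⟨h, β, α⟩
    have := φ.naturality h
    dsimp at this ⊢
    simp only [Functor.map_comp, Category.assoc]
    rw [reassoc_of% this])

/-- A lax square in `Cat` is exact when `φ̃` is an isomorphism of profunctors, that is,
bijective in each component. -/
def IsExact (φ : p ⋙ f ⟶ q ⋙ g) : Prop :=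
  ∀ (a : A) (b : B), Function.Bijective (profTrans φ a b)

end ExactSquare

/-- A functor is inverted by `π₀ : Cat ⥤ Set` when it induces a bijection between the sets of
connected components. -/
def InvertedByPiZero {X : Type u₁} [Category.{v₁} X] {Y : Type u₂} [Category.{v₂} Y]
    (F : X ⥤ Y) : Prop :=
  Function.Bijective F.mapConnectedComponents

section LaxSquare

/-- A lax square of 2-categories with boundary the 2-functors `p`, `q`, `f`, `g`: a 2-natural
transformation `φ` from `f ∘ p` to `g ∘ q`, that is, a family of 1-cells `app x` which is strictly
natural with respect to 1-cells and compatible with 2-cells. -/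
structure LaxSquare {P : Type u₁} [Bicategory.{w₁, v₁} P] {A : Type u₂} [Bicategory.{w₂, v₂} A]
    {B : Type u₃} [Bicategory.{w₃, v₃} B] {C : Type u₄} [Bicategory.{w₄, v₄} C]
    (p : StrictPseudofunctor P A) (q : StrictPseudofunctor P B)
    (f : StrictPseudofunctor A C) (g : StrictPseudofunctor B C) where
  /-- The components `φ_x`. -/
  app (x : P) : f.obj (p.obj x) ⟶ g.obj (q.obj x)
  /-- Naturality with respect to 1-cells, as an equality of 1-cells. -/
  naturality {x y : P} (h : x ⟶ y) :
    f.map (p.map h) ≫ app y = app x ≫ g.map (q.map h)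
  /-- Naturality with respect to 2-cells. The `eqToHom`s are the identity 2-cells which come from
  the naturality with respect to 1-cells. -/
  naturality₂ {x y : P} {h k : x ⟶ y} (η : h ⟶ k) :
    f.map₂ (p.map₂ η) ▷ app y =
      eqToHom (naturality h) ≫ app x ◁ g.map₂ (q.map₂ η) ≫ eqToHom (naturality k).symm

variable {P : Type u₁} [Bicategory.{w₁, v₁} P] {A : Type u₂} [Bicategory.{w₂, v₂} A]
  {B : Type u₃} [Bicategory.{w₃, v₃} B] {C : Type u₄} [Bicategory.{w₄, v₄} C]
  {p : StrictPseudofunctor P A} {q : StrictPseudofunctor P B}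
  {f : StrictPseudofunctor A C} {g : StrictPseudofunctor B C}

/-- The image under `π₀⁎` of (the 2-cell of) a lax square of 2-categories: its component at `x` is
the connected component of `φ_x`. -/
def piZeroStarSquare [Strict P] [Strict A] [Strict B] [Strict C]
    (φ : LaxSquare p q f g) :
    PiZeroStar.map p ⋙ PiZeroStar.map f ⟶ PiZeroStar.map q ⋙ PiZeroStar.map g where
  app x := PiZeroStar.cc (φ.app x.as)
  naturality := by
    rintro x y ⟨h⟩
    exact congrArg PiZeroStar.cc (φ.naturality h)

/-- A lax square of 2-categories is `π₀`-exact when its image under `π₀⁎` is exact in `Cat`. -/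
def IsPiZeroExact [Strict P] [Strict A] [Strict B] [Strict C]
    (φ : LaxSquare p q f g) : Prop :=
  IsExact (piZeroStarSquare φ)

/-- The objects of the category `ℱ(φ,a,b)`: triples `(x, y : q x ⟶ b, z : a ⟶ p x)`. -/
structure FactObj (p : StrictPseudofunctor P A) (q : StrictPseudofunctor P B) (a : A) (b : B) where
  /-- The object of `P`. -/
  x : P
  /-- The 1-cell of `B`. -/
  y : q.obj x ⟶ b
  /-- The 1-cell of `A`. -/
  z : a ⟶ p.obj x

namespace FactObj

variable {a : A} {b : B}

/-- The morphisms of the category `ℱ(φ,a,b)`: triples consisting of a 1-cell `h : x₁ ⟶ x₂` of `P`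
and of 2-cells `h₁ : y₁ ⇒ y₂ ∘ q h` and `h₂ : p h ∘ z₁ ⇒ z₂`. -/
structure Hom (s t : FactObj p q a b) where
  /-- The 1-cell of `P`. -/
  h : s.x ⟶ t.x
  /-- The 2-cell of `B`. -/
  h₁ : s.y ⟶ q.map h ≫ t.y
  /-- The 2-cell of `A`. -/
  h₂ : s.z ≫ p.map h ⟶ t.z

theorem Hom.mk_congr {s t : FactObj p q a b} {h h' : s.x ⟶ t.x} (e : h = h')
    {h₁ : s.y ⟶ q.map h ≫ t.y} {h₁' : s.y ⟶ q.map h' ≫ t.y}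
    {h₂ : s.z ≫ p.map h ⟶ t.z} {h₂' : s.z ≫ p.map h' ⟶ t.z}
    (e₁ : h₁ ≫ eqToHom (by rw [e]) = h₁') (e₂ : h₂ = eqToHom (by rw [e]) ≫ h₂') :
    Hom.mk h h₁ h₂ = Hom.mk h' h₁' h₂' := by
  subst e
  simp_all

variable [Strict P] [Strict A] [Strict B]

/-- The identity of `ℱ(φ,a,b)`, with identity 2-cells. -/
def Hom.id (s : FactObj p q a b) : Hom s s where
  h := 𝟙 s.x
  h₁ := eqToHom (by rw [q.map_id, Strict.id_comp])
  h₂ := eqToHom (by rw [p.map_id, Strict.comp_id])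

/-- Composition in `ℱ(φ,a,b)`, by pasting of 2-cells. -/
def Hom.comp {s t u : FactObj p q a b} (k : Hom s t) (l : Hom t u) : Hom s u where
  h := k.h ≫ l.h
  h₁ := k.h₁ ≫ q.map k.h ◁ l.h₁ ≫ eqToHom (by rw [q.map_comp, Strict.assoc])
  h₂ := eqToHom (by rw [p.map_comp, Strict.assoc]) ≫ k.h₂ ▷ p.map l.h ≫ l.h₂

theorem whiskerLeft_congr {X : Type u₁} [Bicategory.{w₁, v₁} X] {x y z : X} {h h' : x ⟶ y}
    (e : h = h') {k l : y ⟶ z} (η : k ⟶ l) :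
    h ◁ η = eqToHom (by rw [e]) ≫ h' ◁ η ≫ eqToHom (by rw [e]) := by
  subst e; simp

theorem whiskerRight_congr {X : Type u₁} [Bicategory.{w₁, v₁} X] {x y z : X} {h h' : y ⟶ z}
    (e : h = h') {k l : x ⟶ y} (η : k ⟶ l) :
    η ▷ h = eqToHom (by rw [e]) ≫ η ▷ h' ≫ eqToHom (by rw [e]) := by
  subst e; simp

instance : Category (FactObj p q a b) where
  Hom := Hom
  id := Hom.id
  comp := Hom.comp
  id_comp {s t} k := by
    refine Hom.mk_congr (Strict.id_comp _) ?_ ?_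
    · dsimp only [Hom.id, Hom.comp]
      generalize_proofs
      simp [whiskerLeft_congr (q.map_id _), Strict.leftUnitor_eqToIso]
    · dsimp only [Hom.id, Hom.comp]
      generalize_proofs
      simp
  comp_id {s t} k := by
    refine Hom.mk_congr (Strict.comp_id _) ?_ ?_
    · dsimp only [Hom.id, Hom.comp]
      generalize_proofs
      simp
    · dsimp only [Hom.id, Hom.comp]
      generalize_proofs
      simp [whiskerRight_congr (p.map_id _), Strict.rightUnitor_eqToIso]
  assoc {s t u v} k l m := by
    refine Hom.mk_congr (Strict.assoc _ _ _) ?_ ?_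
    · dsimp only [Hom.comp]
      generalize_proofs
      simp [whiskerLeft_congr (q.map_comp _ _), Strict.associator_eqToIso]
    · dsimp only [Hom.comp]
      generalize_proofs
      simp [whiskerRight_congr (p.map_comp _ _), Strict.associator_eqToIso]

end FactObj

namespace FactObj

variable {a : A} {b : B} (φ : LaxSquare p q f g)

/-- The object part of `𝒞(φ,a,b)`: the 1-cell `g y ∘ φ_x ∘ f z`. -/
def val (s : FactObj p q a b) : f.obj a ⟶ g.obj b :=
  f.map s.z ≫ φ.app s.x ≫ g.map s.y

theorem val_middle [Strict C] {x₁ x₂ : P} (h : x₁ ⟶ x₂) (y : q.obj x₂ ⟶ b) (z : a ⟶ p.obj x₁) :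
    f.map z ≫ φ.app x₁ ≫ g.map (q.map h ≫ y) = f.map (z ≫ p.map h) ≫ φ.app x₂ ≫ g.map y := by
  rw [f.map_comp, g.map_comp, Strict.assoc, ← Strict.assoc (φ.app x₁) _ (g.map y),
    ← φ.naturality, Strict.assoc]

/-- The morphism part of `𝒞(φ,a,b)`: the 2-cell obtained by pasting `g h₁` and `f h₂` with the
naturality square of `φ` at `h`. -/
def valMap [Strict C] {s t : FactObj p q a b} (k : Hom s t) : val φ s ⟶ val φ t :=
  f.map s.z ◁ φ.app s.x ◁ g.map₂ k.h₁ ≫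
    eqToHom (val_middle φ k.h t.y s.z) ≫
      f.map₂ k.h₂ ▷ (φ.app t.x ≫ g.map t.y)

end FactObj

section Aux

variable {X : Type u₁} [Bicategory.{w₁, v₁} X] {Y : Type u₂} [Bicategory.{w₂, v₂} Y]

theorem map₂_whiskerLeft_strict (F : StrictPseudofunctor X Y) {x y z : X} (h : x ⟶ y)
    {k l : y ⟶ z} (η : k ⟶ l) :
    F.map₂ (h ◁ η) =
      eqToHom (F.map_comp h k) ≫ F.map h ◁ F.map₂ η ≫ eqToHom (F.map_comp h l).symm := by
  rw [F.map₂_whisker_left, F.mapComp_eq_eqToIso, F.mapComp_eq_eqToIso]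
  rfl

theorem map₂_whiskerRight_strict (F : StrictPseudofunctor X Y) {x y z : X} {k l : x ⟶ y}
    (η : k ⟶ l) (h : y ⟶ z) :
    F.map₂ (η ▷ h) =
      eqToHom (F.map_comp k h) ≫ F.map₂ η ▷ F.map h ≫ eqToHom (F.map_comp l h).symm := by
  rw [F.map₂_whisker_right, F.mapComp_eq_eqToIso, F.mapComp_eq_eqToIso]
  rfl

theorem whiskerLeft_comp_strict [Strict X] {x y z t : X} (h : x ⟶ y) (k : y ⟶ z)
    {l m : z ⟶ t} (η : l ⟶ m) :
    h ◁ k ◁ η = eqToHom (Strict.assoc h k l).symm ≫ (h ≫ k) ◁ η ≫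
      eqToHom (Strict.assoc h k m) := by
  simp [Strict.associator_eqToIso]

theorem whiskerRight_comp_strict [Strict X] {x y z t : X} {l m : x ⟶ y} (η : l ⟶ m)
    (h : y ⟶ z) (k : z ⟶ t) :
    η ▷ h ▷ k = eqToHom (Strict.assoc l h k) ≫ η ▷ (h ≫ k) ≫
      eqToHom (Strict.assoc m h k).symm := by
  simp [Strict.associator_eqToIso]

end Aux

/-- The functor `𝒞(φ,a,b) : ℱ(φ,a,b) ⥤ C(fa,gb)`. -/
def factFunctor [Strict P] [Strict A] [Strict B] [Strict C]
    (φ : LaxSquare p q f g) (a : A) (b : B) :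
    FactObj p q a b ⥤ (f.obj a ⟶ g.obj b) where
  obj s := FactObj.val φ s
  map k := FactObj.valMap φ k
  map_id s := by
    change FactObj.valMap φ (FactObj.Hom.id s) = 𝟙 _
    dsimp only [FactObj.val, FactObj.valMap, FactObj.Hom.id]
    generalize_proofs
    simp only [PrelaxFunctor.map₂_eqToHom, eqToHom_whiskerRight, whiskerLeft_eqToHom,
      eqToHom_trans]
    simp only [eqToHom_refl]
  map_comp {s t u} k l := by
    change FactObj.valMap φ (FactObj.Hom.comp k l) = FactObj.valMap φ k ≫ FactObj.valMap φ l
    have e₁ : f.map s.z ≫ φ.app s.x ≫ g.map (q.map k.h) =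
        f.map (s.z ≫ p.map k.h) ≫ φ.app t.x := by
      rw [f.map_comp, Strict.assoc, φ.naturality]
    have e₂ : f.map (p.map l.h) ≫ φ.app u.x ≫ g.map u.y =
        φ.app t.x ≫ g.map (q.map l.h ≫ u.y) := by
      rw [g.map_comp, ← Strict.assoc, φ.naturality, Strict.assoc]
    have h₁ : f.map s.z ◁ φ.app s.x ◁ g.map₂ (q.map k.h ◁ l.h₁) =
        eqToHom (FactObj.val_middle φ k.h t.y s.z) ≫
          f.map (s.z ≫ p.map k.h) ◁ φ.app t.x ◁ g.map₂ l.h₁ ≫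
            eqToHom (FactObj.val_middle φ k.h _ s.z).symm := by
      simp only [map₂_whiskerLeft_strict, whiskerLeft_comp, whiskerLeft_comp_strict,
        FactObj.whiskerLeft_congr e₁, whiskerLeft_eqToHom, eqToHom_trans, eqToHom_trans_assoc,
        Category.assoc]
    have h₂ : f.map₂ (k.h₂ ▷ p.map l.h) ▷ (φ.app u.x ≫ g.map u.y) =
        eqToHom (FactObj.val_middle φ l.h u.y _).symm ≫
          f.map₂ k.h₂ ▷ (φ.app t.x ≫ g.map (q.map l.h ≫ u.y)) ≫
            eqToHom (FactObj.val_middle φ l.h u.y _) := by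
      simp only [map₂_whiskerRight_strict, comp_whiskerRight, whiskerRight_comp_strict,
        FactObj.whiskerRight_congr e₂, eqToHom_whiskerRight, eqToHom_trans, eqToHom_trans_assoc,
        Category.assoc]
    dsimp only [FactObj.val, FactObj.valMap, FactObj.Hom.comp]
    generalize_proofs
    simp only [PrelaxFunctor.map₂_comp, PrelaxFunctor.map₂_eqToHom, comp_whiskerRight,
      whiskerLeft_comp, h₁, h₂, Category.assoc, eqToHom_whiskerRight, whiskerLeft_eqToHom,
      eqToHom_trans, eqToHom_trans_assoc, whisker_exchange_assoc, eqToHom_refl,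
      Category.id_comp]

end LaxSquare

end PiZeroExact

/-! The domain of `profTrans` at `(a, b)` is already the set of components of `ℱ(φ,a,b)`. Two kinds
of identification produce the coend from triples `(x, y, z)`: passing to components of the legs `y`
and `z`, and sliding a 1-cell `h` of `P` from one leg to the other. A morphism `(h, h₁, h₂)` does
both at once: `h₁` and `h₂` become equalities under `π₀`, and what is left is a generator of
`CoendRel`. Conversely, `homOfLeft`, `homOfRight` and `homOfBase` realize each identification by a
morphism of `ℱ(φ,a,b)`.

This gives the bijection `componentsEquivProfComp`. Through it `profTrans` becomes `π₀` of
`𝒞(φ,a,b)`, since both send the class of `(x, y, z)` to the component of `g y ∘ φ_x ∘ f z`. Hence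
one is bijective exactly when the other is, for each `a` and `b` separately. -/

namespace PiZeroExact

section Comparison

variable {P : Type u₁} [Bicategory.{w₁, v₁} P] [Strict P]
  {A : Type u₂} [Bicategory.{w₂, v₂} A] [Strict A]
  {B : Type u₃} [Bicategory.{w₃, v₃} B] [Strict B]
  {C : Type u₄} [Bicategory.{w₄, v₄} C] [Strict C]
  {p : StrictPseudofunctor P A} {q : StrictPseudofunctor P B}
  {f : StrictPseudofunctor A C} {g : StrictPseudofunctor B C} {a : A} {b : B}

namespace FactObj

/-- The morphism of `ℱ(φ,a,b)` induced by a 2-cell between the legs in `B`. -/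
def homOfLeft {x : P} {y y' : q.obj x ⟶ b} (η : y ⟶ y') (z : a ⟶ p.obj x) :
    (⟨x, y, z⟩ : FactObj p q a b) ⟶ ⟨x, y', z⟩ :=
  Hom.mk (𝟙 x) (η ≫ eqToHom (by rw [q.map_id, Strict.id_comp]))
    (eqToHom (by rw [p.map_id, Strict.comp_id]))

/-- The morphism of `ℱ(φ,a,b)` induced by a 2-cell between the legs in `A`. -/
def homOfRight {x : P} (y : q.obj x ⟶ b) {z z' : a ⟶ p.obj x} (η : z ⟶ z') :
    (⟨x, y, z⟩ : FactObj p q a b) ⟶ ⟨x, y, z'⟩ :=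
  Hom.mk (𝟙 x) (eqToHom (by rw [q.map_id, Strict.id_comp]))
    (eqToHom (by rw [p.map_id, Strict.comp_id]) ≫ η)

/-- The morphism of `ℱ(φ,a,b)` with identity 2-cells over a 1-cell of `P`. -/
def homOfBase {x₁ x₂ : P} (h : x₁ ⟶ x₂) (y : q.obj x₂ ⟶ b) (z : a ⟶ p.obj x₁) :
    (⟨x₁, q.map h ≫ y, z⟩ : FactObj p q a b) ⟶ ⟨x₂, y, z ≫ p.map h⟩ :=
  Hom.mk h (𝟙 _) (𝟙 _)

/-- The element of the coend represented by components of 1-cells of `B` and of `A`. -/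
def profCompMk (p : StrictPseudofunctor P A) (q : StrictPseudofunctor P B) {a : A} {b : B}
    (x : P) (s : CategoryTheory.ConnectedComponents (q.obj x ⟶ b))
    (t : CategoryTheory.ConnectedComponents (a ⟶ p.obj x)) :
    ProfComp (PiZeroStar.map p) (PiZeroStar.map q) ⟨a⟩ ⟨b⟩ :=
  Quot.mk _ ⟨⟨x⟩, (s, t)⟩

/-- The element of the coend represented by an object of `ℱ(φ,a,b)`. -/
def toProfComp (s : FactObj p q a b) :
    ProfComp (PiZeroStar.map p) (PiZeroStar.map q) ⟨a⟩ ⟨b⟩ :=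
  profCompMk p q s.x (PiZeroStar.cc s.y) (PiZeroStar.cc s.z)

/-- The 2-cells of `k` matter only through the components they connect; the 1-cell `k.h` then
supplies one generating identification of the coend. -/
theorem toProfComp_eq_of_hom {s t : FactObj p q a b} (k : Hom s t) :
    toProfComp s = toProfComp t := by
  have e₁ : PiZeroStar.cc s.y = PiZeroStar.cc (q.map k.h ≫ t.y) :=
    Quotient.sound (Zigzag.of_hom k.h₁)
  have e₂ : PiZeroStar.cc (s.z ≫ p.map k.h) = PiZeroStar.cc t.z :=
    Quotient.sound (Zigzag.of_hom k.h₂)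
  unfold toProfComp
  -- Only the leg of `s` in `B` and the leg of `t` in `A` are replaced, which brings the two sides
  -- into the shape of `CoendRel.intro`.
  rw [e₁, ← e₂]
  exact Quot.sound (CoendRel.intro (p := PiZeroStar.map p) (q := PiZeroStar.map q)
    (a := ⟨a⟩) (b := ⟨b⟩) (x₁ := ⟨s.x⟩) (x₂ := ⟨t.x⟩)
    (PiZeroStar.cc k.h) (PiZeroStar.cc t.y) (PiZeroStar.cc s.z))

theorem toProfComp_eq_of_zigzag {s t : FactObj p q a b} (h : Zigzag s t) :
    toProfComp s = toProfComp t := by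
  induction h with
  | refl => rfl
  | tail _ h ih =>
    rcases h with ⟨⟨k⟩⟩ | ⟨⟨k⟩⟩
    · exact ih.trans (toProfComp_eq_of_hom k)
    · exact ih.trans (toProfComp_eq_of_hom k).symm

/-- With `zigzag_right`, this makes the component of `(x, y, z)` depend only on the components of
its legs. -/
theorem zigzag_left {x : P} {y y' : q.obj x ⟶ b} (h : Zigzag y y') (z : a ⟶ p.obj x) :
    Zigzag (⟨x, y, z⟩ : FactObj p q a b) ⟨x, y', z⟩ := by
  induction h with
  | refl => exact .refl _
  | tail _ h ih =>
    rcases h with ⟨⟨k⟩⟩ | ⟨⟨k⟩⟩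
    · exact ih.trans (.of_hom (homOfLeft k z))
    · exact ih.trans (.of_inv (homOfLeft k z))

theorem zigzag_right {x : P} (y : q.obj x ⟶ b) {z z' : a ⟶ p.obj x} (h : Zigzag z z') :
    Zigzag (⟨x, y, z⟩ : FactObj p q a b) ⟨x, y, z'⟩ := by
  induction h with
  | refl => exact .refl _
  | tail _ h ih =>
    rcases h with ⟨⟨k⟩⟩ | ⟨⟨k⟩⟩
    · exact ih.trans (.of_hom (homOfRight y k))
    · exact ih.trans (.of_inv (homOfRight y k))

end FactObj

/-- The component of `ℱ(φ,a,b)` determined by components of 1-cells of `B` and of `A`. -/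
def componentOfLegs (p : StrictPseudofunctor P A) (q : StrictPseudofunctor P B) {a : A} {b : B}
    (x : P) (s : CategoryTheory.ConnectedComponents (q.obj x ⟶ b))
    (t : CategoryTheory.ConnectedComponents (a ⟶ p.obj x)) :
    CategoryTheory.ConnectedComponents (FactObj p q a b) :=
  Quotient.map₂ (fun y z => (⟨x, y, z⟩ : FactObj p q a b))
    (fun _ _ hy _ _ hz => (FactObj.zigzag_left hy _).trans (FactObj.zigzag_right _ hz)) s t

/-- The connected components of `ℱ(φ,a,b)` form the coend `∫^x π₀ B(qx,b) × π₀ A(a,px)`. -/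
def componentsEquivProfComp (p : StrictPseudofunctor P A) (q : StrictPseudofunctor P B)
    (a : A) (b : B) :
    CategoryTheory.ConnectedComponents (FactObj p q a b) ≃
      ProfComp (PiZeroStar.map p) (PiZeroStar.map q) ⟨a⟩ ⟨b⟩ where
  toFun := Quotient.lift FactObj.toProfComp fun _ _ h => FactObj.toProfComp_eq_of_zigzag h
  invFun := Quot.lift (fun s => componentOfLegs p q s.1.as s.2.1 s.2.2) (by
    -- A generator of the relation involves components of 1-cells. Once representatives are chosen,
    -- its two sides are the ends of `homOfBase`.
    rintro _ _ ⟨⟨h⟩, ⟨y⟩, ⟨z⟩⟩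
    exact Quotient.sound (Zigzag.of_hom (FactObj.homOfBase h y z)))
  left_inv := by
    rintro ⟨s⟩
    rfl
  right_inv := by
    rintro ⟨x, ⟨y⟩, ⟨z⟩⟩
    rfl

/-- On a representative, both sides unfold to the component of the same 1-cell, because composition
in `π₀⁎ C` is computed on representatives. -/
theorem profTrans_componentsEquivProfComp (φ : LaxSquare p q f g) (a : A) (b : B)
    (s : CategoryTheory.ConnectedComponents (FactObj p q a b)) :
    profTrans (piZeroStarSquare φ) ⟨a⟩ ⟨b⟩ (componentsEquivProfComp p q a b s) =
      (factFunctor φ a b).mapConnectedComponents s := by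
  obtain ⟨s⟩ := s
  rfl

theorem bijective_profTrans_iff (φ : LaxSquare p q f g) (a : A) (b : B) :
    Function.Bijective (profTrans (piZeroStarSquare φ) ⟨a⟩ ⟨b⟩) ↔
      InvertedByPiZero (factFunctor φ a b) := by
  have h : (factFunctor φ a b).mapConnectedComponents =
      profTrans (piZeroStarSquare φ) ⟨a⟩ ⟨b⟩ ∘ componentsEquivProfComp p q a b :=
    funext fun s => (profTrans_componentsEquivProfComp φ a b s).symm
  unfold InvertedByPiZero
  rw [h]
  -- Precomposition with a bijection neither creates nor destroys bijectivity.
  exact ((componentsEquivProfComp p q a b).bijective_comp _).symm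

end Comparison

end PiZeroExact

/-- A lax square of 2-categories is `π₀`-exact if and only if for all objects `a` and `b` the
functor `𝒞(φ,a,b) : ℱ(φ,a,b) ⥤ C(fa,gb)` is inverted by `π₀`. -/
theorem proposition5p17
    {P : Type u₁} [Bicategory.{w₁, v₁} P] [Bicategory.Strict P]
    {A : Type u₂} [Bicategory.{w₂, v₂} A] [Bicategory.Strict A]
    {B : Type u₃} [Bicategory.{w₃, v₃} B] [Bicategory.Strict B]
    {C : Type u₄} [Bicategory.{w₄, v₄} C] [Bicategory.Strict C]
    (p : StrictPseudofunctor P A) (q : StrictPseudofunctor P B)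
    (f : StrictPseudofunctor A C) (g : StrictPseudofunctor B C)
    (φ : PiZeroExact.LaxSquare p q f g) :
    PiZeroExact.IsPiZeroExact φ ↔
      ∀ (a : A) (b : B), PiZeroExact.InvertedByPiZero (PiZeroExact.factFunctor φ a b) :=
  ⟨fun h a b => (PiZeroExact.bijective_profTrans_iff φ a b).1 (h ⟨a⟩ ⟨b⟩),
    fun h a b => (PiZeroExact.bijective_profTrans_iff φ a.as b.as).2 (h a.as b.as)⟩
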